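/- **Setting.** Let $X$ and $Y$ be smooth paracompact Hausdorff manifolds, $\dim X=n$, $\dim Y=m$, with $X$ oriented, and let $C^\infty(Y)$ denote the smooth $\mathbb K$-valued functions on $Y$, where $\mathbb K=\mathbb R$ or $\mathbb K=\mathbb C$. Let $\Omega^n_c(X)$ be the space of smooth compactly supported $n$-forms on $X$ with its (LF-)topology and $\hat{\mathcal U}_0(X)=\{\omega\in\Omega^n_c(X):\int_X\omega=1\}$. Smoothness of maps on or into $\hat{\mathcal U}_0(X)$ is understood in the sense of convenient calculus (smooth curves are mapped to smooth curves). A *smoothing kernel* on $X$ is a map $\Phi\in C^\infty((0,1]\times X,\hat{\mathcal U}_0(X))$ such that, for any Riemannian metric on $X$ and every compact $K\subseteq X$, 1. there are $\varepsilon_0,C>0$ with $\operatorname{supp}\Phi(\varepsilon,p)\subseteq B_{\varepsilon C}(p)$ for all $p\in K$ and $\varepsilon\le\varepsilon_0$; 2. for all $k,l\in\mathbb N_0$ and all smooth vector fields $\zeta_1,\dots,\zeta_k,\theta_1,\dots,\theta_l$ on $X$, $$\sup_{p\in K,\;q\in X}\bigl\|L_{\theta_1}\cdots L_{\theta_l}(L'_{\zeta_1}+L_{\zeta_1})\cdots(L'_{\zeta_k}+L_{\zeta_k})\Phi(\varepsilon,p)(q)\bigr\|=O(\varepsilon^{-(n+l)})\qquad(\varepsilon\to0),$$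 where $L_\theta$ is the Lie derivative of the $n$-form $\Phi(\varepsilon,p)$ and $L'_\zeta$ is the derivative along $\zeta$ in the variable $p$. Let $\tilde{\mathcal A}_0(X)$ be the set of smoothing kernels on $X$. For a smooth manifold $Z$, an element $S\in C^\infty(\hat{\mathcal U}_0(X)\times X,Z)$ is called *c-bounded* if for every compact $K\subseteq X$ there is a compact $L\subseteq Z$ such that for every $\Phi\in\tilde{\mathcal A}_0(X)$ there is $\varepsilon_0>0$ with $S(\Phi(\varepsilon,p),p)\in L$ for all $\varepsilon\in(0,1]$ with $\varepsilon<\varepsilon_0$ and all $p\in K$. **Proposition.** Let $R\in C^\infty(\hat{\mathcal U}_0(X)\times X,Y)$. The following conditions are equivalent: (i) $R$ is c-bounded; (ii) $f\circ R$ is c-bounded (as an element of $C^\infty(\hat{\mathcal U}_0(X)\times X,\mathbb K)$) for every $f\in C^\infty(Y)$. -/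

import Mathlib

open Set Filter MeasureTheory
open scoped Manifold ContDiff Topology Bundle

namespace FullColombeau

noncomputable section

/-- The model space `ℝⁿ`, with its Euclidean norm. -/
abbrev Model (n : ℕ) : Type := EuclideanSpace ℝ (Fin n)

/-- Alternating `n`-linear forms on `ℝⁿ`, the fibre type of the bundle of `n`-forms. -/
abbrev TopAlt (n : ℕ) : Type := Model n [⋀^Fin n]→L[ℝ] ℝ

/-- Not necessarily smooth `n`-forms on a manifold `X` modelled on `ℝⁿ`: to each point `p` one
assigns an alternating `n`-linear form on the tangent space at `p`. (In Mathlib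
`TangentSpace (𝓡 n) p` is by definition the model space `ℝⁿ`.) -/
abbrev TopForm (n : ℕ) (X : Type*) : Type _ := X → TopAlt n

/-- The Jacobian determinant of a map `ℝⁿ → ℝⁿ` at a point. -/
def jacobian {n : ℕ} (f : Model n → Model n) (x : Model n) : ℝ :=
  LinearMap.det ((fderiv ℝ f x : Model n →L[ℝ] Model n) : Model n →ₗ[ℝ] Model n)

/-- An oriented atlas of a smooth `n`-manifold: a family of charts from the smooth structure that
covers `X` and whose changes of charts have positive Jacobian determinant. It is the datum that
makes `X` an oriented manifold. -/
structure OrientedAtlas (n : ℕ) (X : Type*) [TopologicalSpace X] [ChartedSpace (Model n) X] where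
  charts : Set (OpenPartialHomeomorph X (Model n))
  subset_maximalAtlas : charts ⊆ IsManifold.maximalAtlas (𝓡 n) ∞ X
  cover : ∀ p : X, ∃ e ∈ charts, p ∈ e.source
  jacobian_pos : ∀ e ∈ charts, ∀ e' ∈ charts, ∀ x ∈ e.target, e.symm x ∈ e'.source →
    0 < jacobian (fun y => e' (e.symm y)) x

section Forms

variable {n : ℕ} {X : Type*} [TopologicalSpace X] [ChartedSpace (Model n) X]

/-- The differential of a chart, as a linear map of the model space. -/
def chartDeriv (e : OpenPartialHomeomorph X (Model n)) (p : X) : Model n →L[ℝ] Model n :=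
  mfderiv (𝓡 n) (𝓡 n) e p

/-- The differential of the inverse of a chart, as a linear map of the model space. -/
def chartSymmDeriv (e : OpenPartialHomeomorph X (Model n)) (x : Model n) : Model n →L[ℝ] Model n :=
  mfderiv (𝓡 n) (𝓡 n) e.symm x

/-- The local expression `φ_* ν = (φ⁻¹)^* ν` of an `n`-form in a chart `φ`; it is meaningful
on the target of the chart. -/
def pushForm (e : OpenPartialHomeomorph X (Model n)) (ν : TopForm n X) (x : Model n) : TopAlt n :=
  (ν (e.symm x)).compContinuousLinearMap (chartSymmDeriv e x)

/-- The function `x ↦ α(x)(e₁, …, eₙ)` of an `n`-form `α` on (an open set of) `ℝⁿ`. -/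
def lambdaHat (α : Model n → TopAlt n) (x : Model n) : ℝ :=
  α x (fun i => EuclideanSpace.single i (1 : ℝ))

/-- An `n`-form is smooth if its local expression in each chart is smooth. -/
def IsSmoothForm (ν : TopForm n X) : Prop :=
  ∀ e ∈ IsManifold.maximalAtlas (𝓡 n) ∞ X, ContDiffOn ℝ ∞ (pushForm e ν) e.target

theorem pushForm_zero (e : OpenPartialHomeomorph X (Model n)) :
    pushForm e (0 : TopForm n X) = 0 := by
  funext x; ext v; simp [pushForm]

theorem pushForm_add (e : OpenPartialHomeomorph X (Model n)) (ν η : TopForm n X) :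
    pushForm e (ν + η) = pushForm e ν + pushForm e η := by
  funext x; ext v; simp [pushForm]

theorem pushForm_smul (e : OpenPartialHomeomorph X (Model n)) (c : ℝ) (ν : TopForm n X) :
    pushForm e (c • ν) = c • pushForm e ν := by
  funext x; ext v; simp [pushForm]

variable (n X) in
/-- The smooth compactly supported `n`-forms on `X`, as a subspace of the space of all `n`-forms. -/
def compactFormSubmodule : Submodule ℝ (TopForm n X) where
  carrier := {ν | IsSmoothForm ν ∧ HasCompactSupport ν}
  zero_mem' := by
    refine ⟨fun e _ => ?_, HasCompactSupport.zero⟩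
    rw [pushForm_zero]
    exact contDiffOn_const
  add_mem' := by
    rintro ν η ⟨h₁, h₂⟩ ⟨h₃, h₄⟩
    refine ⟨fun e he => ?_, h₂.add h₄⟩
    rw [pushForm_add]
    exact (h₁ e he).add (h₃ e he)
  smul_mem' := by
    rintro c ν ⟨h₁, h₂⟩
    refine ⟨fun e he => ?_, h₂.smul_left (f := fun _ => c)⟩
    rw [pushForm_smul]
    exact (h₁ e he).const_smul c

variable (n X) in
/-- The vector space `Ωⁿ_c(X)` of smooth compactly supported `n`-forms on `X`. -/
def CompactForm : Type _ := ↥(compactFormSubmodule n X)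

instance : AddCommGroup (CompactForm n X) :=
  inferInstanceAs (AddCommGroup ↥(compactFormSubmodule n X))

instance : Module ℝ (CompactForm n X) :=
  inferInstanceAs (Module ℝ ↥(compactFormSubmodule n X))

/-- The `n`-form underlying an element of `Ωⁿ_c(X)`. -/
def CompactForm.toForm (ν : CompactForm n X) : TopForm n X := ν.1

theorem CompactForm.toForm_add (ν η : CompactForm n X) :
    (ν + η).toForm = ν.toForm + η.toForm := rfl

theorem CompactForm.toForm_smul (c : ℝ) (ν : CompactForm n X) :
    (c • ν).toForm = c • ν.toForm := rfl

/-- The seminorms on `Ωⁿ_c(X)` that are continuous for its usual (LF-)topology, the inductive limit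
topology of the Fréchet spaces `Ωⁿ_K(X)` of forms supported in `K`, for `K ⊆ X` compact: on
each `Ωⁿ_K(X)` the seminorm is bounded by a multiple of the maximum of finitely many of the
seminorms `ν ↦ sup_{x ∈ C} ‖D^k (φ_* ν)(x)‖`, for `φ` a chart, `C` a compact subset of its
target and `k` a natural number. -/
def IsContinuousSeminorm (s : Seminorm ℝ (CompactForm n X)) : Prop :=
  ∀ K : Set X, IsCompact K →
    ∃ (N : ℕ) (e : Fin N → OpenPartialHomeomorph X (Model n)) (C : Fin N → Set (Model n))
      (k : Fin N → ℕ) (B : ℝ),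
      (∀ i, e i ∈ IsManifold.maximalAtlas (𝓡 n) ∞ X ∧ IsCompact (C i) ∧ C i ⊆ (e i).target) ∧
      ∀ ν : CompactForm n X, tsupport ν.toForm ⊆ K → ∀ M : ℝ, 0 ≤ M →
        (∀ i, ∀ x ∈ C i,
          ‖iteratedFDeriv ℝ (k i) (pushForm (e i) ν.toForm) x‖ ≤ M) →
        s ν ≤ B * M

/-- The curve `c` in the locally convex space `Ωⁿ_c(X)` has derivative `c'` at `t`, i.e. the
difference quotients converge to `c'` in the topology of `Ωⁿ_c(X)`. -/
def HasFormDerivAt (c : ℝ → CompactForm n X) (c' : CompactForm n X) (t : ℝ) : Prop :=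
  ∀ s : Seminorm ℝ (CompactForm n X), IsContinuousSeminorm s →
    Tendsto (fun h : ℝ => s (h⁻¹ • (c (t + h) - c t) - c')) (𝓝[≠] 0) (𝓝 0)

/-- A curve in the locally convex space `Ωⁿ_c(X)` is smooth if all its iterated derivatives
exist. -/
def IsSmoothFormCurve (c : ℝ → CompactForm n X) : Prop :=
  ∃ d : ℕ → ℝ → CompactForm n X, d 0 = c ∧ ∀ k t, HasFormDerivAt (d k) (d (k + 1) t) t

/-- `∫_X ν = a` for a smooth compactly supported `n`-form `ν` on the oriented manifold `X`: `ν` is a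
finite sum of smooth forms `ηᵢ` with compact support in the domain of a positively oriented chart
`φᵢ`, and `a` is the sum of the Lebesgue integrals of the functions `(φᵢ)_* ηᵢ (e₁, …, eₙ)`. -/
def HasIntegral (A : OrientedAtlas n X) (ν : CompactForm n X) (a : ℝ) : Prop :=
  ∃ (N : ℕ) (e : Fin N → OpenPartialHomeomorph X (Model n)) (η : Fin N → CompactForm n X),
    (∀ i, e i ∈ A.charts ∧ tsupport (η i).toForm ⊆ (e i).source) ∧
    ν = ∑ i, η i ∧
    a = ∑ i, ∫ x in (e i).target, lambdaHat (pushForm (e i) (η i).toForm) x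

/-- The set `Û₀(X)` of smooth compactly supported `n`-forms on `X` with integral one. -/
def UHat (A : OrientedAtlas n X) : Type _ := {ν : CompactForm n X // HasIntegral A ν 1}

/-- The underlying form of an element of `Û₀(X)`. -/
def UHat.form {A : OrientedAtlas n X} (ν : UHat A) : CompactForm n X := ν.1

/-- A curve in `Û₀(X)`, an affine subspace of `Ωⁿ_c(X)`, is smooth if it is smooth as a curve
in `Ωⁿ_c(X)`. -/
def IsSmoothUHatCurve {A : OrientedAtlas n X} (c : ℝ → UHat A) : Prop :=
  IsSmoothFormCurve (fun t => (c t).form)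

/-- Smooth vector fields on `X`. -/
abbrev SmoothVectorField (n : ℕ) (X : Type*) [TopologicalSpace X] [ChartedSpace (Model n) X]
    [IsManifold (𝓡 n) ∞ X] : Type _ :=
  ContMDiffSection (𝓡 n) (Model n) ∞ (fun p : X => TangentSpace (𝓡 n) p)

variable [IsManifold (𝓡 n) ∞ X]

/-- The local expression of a vector field `θ` in a chart. -/
def pushField (e : OpenPartialHomeomorph X (Model n)) (θ : SmoothVectorField n X)
    (x : Model n) : Model n :=
  chartDeriv e (e.symm x) (θ (e.symm x))

/-- The Lie derivative `L_θ ν` of an `n`-form. At `q` it is computed in the chart at `q`, by the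
coordinate formula `L_θ α = D_θ α + div(θ) α` for forms `α` of top degree on `ℝⁿ`, and pulled
back to the manifold. -/
def lieForm (θ : SmoothVectorField n X) (ν : TopForm n X) : TopForm n X := fun q =>
  let e := chartAt (Model n) q
  let D : Model n →L[ℝ] Model n := fderiv ℝ (pushField e θ) (e q)
  (fderiv ℝ (pushForm e ν) (e q) (pushField e θ (e q)) +
      LinearMap.trace ℝ (Model n) (D : Model n →ₗ[ℝ] Model n) • pushForm e ν (e q)
    ).compContinuousLinearMap (chartDeriv e q)

/-- `(L_θ Ψ)(p)(q)` for a family `Ψ` of `n`-forms `Ψ(p)`, `p ∈ X`: the Lie derivative acts on the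
form `Ψ(p)`. -/
def lieOnForm (θ : SmoothVectorField n X) (Ψ : X → TopForm n X) : X → TopForm n X :=
  fun p => lieForm θ (Ψ p)

/-- `(L'_ζ Ψ)(p)(q)` for a family `Ψ` of `n`-forms `Ψ(p)`, `p ∈ X`: the derivative, in the
direction `ζ(p)`, of the map `p ↦ Ψ(p)(q)` into the fixed vector space of `n`-forms on the
tangent space at `q`. -/
def lieOnParam (ζ : SmoothVectorField n X) (Ψ : X → TopForm n X) : X → TopForm n X :=
  fun p q => mfderiv (𝓡 n) 𝓘(ℝ, TopAlt n) (fun p' => Ψ p' q) p (ζ p)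

/-- `L_{θ₁} ⋯ L_{θ_l} (L'_{ζ₁} + L_{ζ₁}) ⋯ (L'_{ζ_k} + L_{ζ_k}) Ψ`. -/
def iteratedLie (θ ζ : List (SmoothVectorField n X)) (Ψ : X → TopForm n X) : X → TopForm n X :=
  θ.foldr lieOnForm (ζ.foldr (fun ξ Ψ' => lieOnParam ξ Ψ' + lieOnForm ξ Ψ') Ψ)

variable (n X) in
/-- Smooth Riemannian metrics on `X`. -/
abbrev SmoothMetric : Type _ :=
  Bundle.ContMDiffRiemannianMetric (𝓡 n) ∞ (Model n) (fun p : X => TangentSpace (𝓡 n) p)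

/-- The open ball of radius `r` around `p` for the distance of a Riemannian metric. -/
def metricBall (g : SmoothMetric n X) (p : X) (r : ℝ) : Set X :=
  letI : Bundle.RiemannianBundle (fun p : X => TangentSpace (𝓡 n) p) := ⟨g.toRiemannianMetric⟩
  {q | Manifold.riemannianEDist (𝓡 n) p q < ENNReal.ofReal r}

/-- `‖α‖_g ≤ B` for an alternating form `α` on the tangent space at `q`, with the operator norm
with respect to the norm `√(g(v,v))` on that space. -/
def FormNormLE (g : SmoothMetric n X) (q : X) (α : TopAlt n) (B : ℝ) : Prop :=
  ∀ v : Fin n → TangentSpace (𝓡 n) q,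
    |α (fun i => (v i : Model n))| ≤ B * ∏ i, Real.sqrt (g.inner q (v i) (v i))

/-- The space of smoothing kernels on the oriented manifold `X`: maps
`Φ ∈ C^∞((0,1] × X, Û₀(X))` such that, for any Riemannian metric on `X`,
(i) on compact sets of `p`, the support of `Φ(ε,p)` is eventually in a ball `B_{εC}(p)`;
(ii) `‖L_{θ₁} ⋯ L_{θ_l} (L'_{ζ₁} + L_{ζ₁}) ⋯ (L'_{ζ_k} + L_{ζ_k}) Φ(ε,p)(q)‖ = O(ε^{-(n+l)})`
uniformly for `p` in compact sets and `q ∈ X`. Smoothness, as always in convenient calculus, means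
that smooth curves are mapped to smooth curves. -/
structure SmoothingKernel (A : OrientedAtlas n X) where
  toFun : Ioc (0 : ℝ) 1 → X → UHat A
  smooth : ∀ (τ : ℝ → Ioc (0 : ℝ) 1) (γ : ℝ → X), ContDiff ℝ ∞ (fun t => (τ t : ℝ)) →
    ContMDiff 𝓘(ℝ, ℝ) (𝓡 n) ∞ γ → IsSmoothUHatCurve (fun t => toFun (τ t) (γ t))
  support_subset : ∀ g : SmoothMetric n X, ∀ K : Set X, IsCompact K →
    ∃ ε₀ > (0 : ℝ), ∃ C > (0 : ℝ), ∀ p ∈ K, ∀ ε : Ioc (0 : ℝ) 1, (ε : ℝ) ≤ ε₀ →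
      tsupport (toFun ε p).form.toForm ⊆ metricBall g p (ε * C)
  lie_bound : ∀ g : SmoothMetric n X, ∀ K : Set X, IsCompact K →
    ∀ θ ζ : List (SmoothVectorField n X),
      ∃ ε₀ > (0 : ℝ), ∃ C > (0 : ℝ), ∀ ε : Ioc (0 : ℝ) 1, (ε : ℝ) ≤ ε₀ → ∀ p ∈ K, ∀ q : X,
        FormNormLE g q
          (iteratedLie θ ζ (fun p' => (toFun ε p').form.toForm) p q)
          (C * ((ε : ℝ) ^ (n + θ.length))⁻¹)

end Forms

section Basic

variable {n : ℕ} {X : Type*} [TopologicalSpace X] [ChartedSpace (Model n) X]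
  {F : Type*} [NormedAddCommGroup F] [NormedSpace ℝ F] {H : Type*} [TopologicalSpace H]
  {Y : Type*} [TopologicalSpace Y] [ChartedSpace H Y]

/-- The basic space `C^∞(Û₀(X) × X, Y)`: maps that send smooth curves in `Û₀(X) × X` to
smooth curves in `Y`, which is smoothness in the sense of convenient calculus. -/
structure BasicSpace (A : OrientedAtlas n X) (J : ModelWithCorners ℝ F H) (Y : Type*)
    [TopologicalSpace Y] [ChartedSpace H Y] where
  toFun : UHat A → X → Y
  smooth : ∀ (c : ℝ → UHat A) (γ : ℝ → X), IsSmoothUHatCurve c →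
    ContMDiff 𝓘(ℝ, ℝ) (𝓡 n) ∞ γ → ContMDiff 𝓘(ℝ, ℝ) J ∞ (fun t => toFun (c t) (γ t))

/-- The composition `f ∘ R ∈ C^∞(Û₀(X) × X, Z)` of `R ∈ C^∞(Û₀(X) × X, Y)` with
`f ∈ C^∞(Y, Z)`. -/
def BasicSpace.postcomp {A : OrientedAtlas n X} {J : ModelWithCorners ℝ F H}
    {F' : Type*} [NormedAddCommGroup F'] [NormedSpace ℝ F'] {H' : Type*} [TopologicalSpace H']
    {J' : ModelWithCorners ℝ F' H'} {Z : Type*} [TopologicalSpace Z] [ChartedSpace H' Z]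
    (f : ContMDiffMap J J' Y Z ∞) (R : BasicSpace A J Y) : BasicSpace A J' Z where
  toFun ν p := f (R.toFun ν p)
  smooth c γ hc hγ := f.contMDiff.comp (R.smooth c γ hc hγ)

/-- c-boundedness: for each compact `K ⊆ X` there is a compact `L ⊆ Y` such that for all smoothing
kernels `Φ` one has `R(Φ(ε,p),p) ∈ L` for all small `ε` and all `p ∈ K`. -/
def BasicSpace.CBounded [IsManifold (𝓡 n) ∞ X] {A : OrientedAtlas n X}
    {J : ModelWithCorners ℝ F H} (R : BasicSpace A J Y) : Prop :=
  ∀ K : Set X, IsCompact K → ∃ L : Set Y, IsCompact L ∧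
    ∀ Φ : SmoothingKernel A, ∃ ε₀ > (0 : ℝ), ∀ ε : Ioc (0 : ℝ) 1, (ε : ℝ) < ε₀ →
      ∀ p ∈ K, R.toFun (Φ.toFun ε p) p ∈ L

end Basic

end

end FullColombeau

/-!
A map `R` from `Û₀(X) × X` is controlled on a compact set `K ⊆ X` by two facts.

* `Û₀(X)` is an affine space, so any two of its elements are joined by a smooth line, and nearby
  points of `X` are joined by smooth curves. Since `R` maps smooth curves to smooth curves, and
  since `K` is covered by finitely many small sets, `R(Û₀(X) × K)` is contained in every clopen
  subset of `Y` that contains a certain finite set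
  (`FullColombeau.BasicSpace.exists_finite_forall_isClopen_mem`).
* `Y` need not be `σ`-compact, but as it is locally compact and paracompact every compact set lies
  in a `σ`-compact clopen set (`IsCompact.exists_isClopen_isSigmaCompact_superset`), and on such a
  set there is a smooth function with relatively compact sublevel sets, which extends
  by zero to `Y` (`FullColombeau.exists_contMDiffMap_isCompact_sublevel`).

If `f` is such a function on a `σ`-compact clopen set `S` containing `R(Û₀(X) × K)`, then a bound
for `f ∘ R` on `K` confines the values `R(Φ(ε,p),p)` to a compact subset of `S`, and neither `f`
nor this subset depends on `Φ`. The converse holds because `f(L)` is compact for compact `L`.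
-/

/-! ### Clopen σ-compact neighbourhoods -/

/-- A locally compact paracompact space is covered by its `σ`-compact clopen subsets: given a
locally finite cover by relatively compact open sets, the points reached from a compact set by
finite chains of members of the cover form such a subset. -/
theorem IsCompact.exists_isClopen_isSigmaCompact_superset {Y : Type*} [TopologicalSpace Y]
    [ParacompactSpace Y] [WeaklyLocallyCompactSpace Y] {s : Set Y} (hs : IsCompact s) :
    ∃ S : Set Y, IsClopen S ∧ IsSigmaCompact S ∧ s ⊆ S := by
  choose k hkc hk using fun y : Y => exists_compact_mem_nhds y
  obtain ⟨v, hvo, hvc, hvf, hvk⟩ := precise_refinement (fun y => interior (k y))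
    (fun _ => isOpen_interior)
    (iUnion_eq_univ_iff.2 fun y => ⟨y, mem_interior_iff_mem_nhds.2 (hk y)⟩)
  have step : ∀ C : {C : Set Y // IsCompact C}, ∃ C' : {C : Set Y // IsCompact C},
      ∀ i, (v i ∩ C.1).Nonempty → v i ⊆ C'.1 := by
    rintro ⟨C, hC⟩
    have hfin : {i | (v i ∩ C).Nonempty}.Finite := hvf.finite_nonempty_inter_compact hC
    refine ⟨⟨⋃ i ∈ {i | (v i ∩ C).Nonempty}, k i, hfin.isCompact_biUnion fun i _ => hkc i⟩, ?_⟩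
    intro i hi
    exact ((hvk i).trans interior_subset).trans
      (subset_biUnion_of_mem (u := k) (show i ∈ {i | (v i ∩ C).Nonempty} from hi))
  choose F hF using step
  let K : ℕ → {C : Set Y // IsCompact C} := fun j => F^[j] ⟨s, hs⟩
  have hK : ∀ j i, (v i ∩ (K j).1).Nonempty → v i ⊆ ⋃ j, (K j).1 := by
    intro j i h
    refine Subset.trans ?_ (subset_iUnion (fun j => (K j).1) (j + 1))
    have : K (j + 1) = F (K j) := Function.iterate_succ_apply' F j _
    rw [this]
    exact hF _ i h
  have hv : ∀ y, ∃ i, y ∈ v i := iUnion_eq_univ_iff.1 hvc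
  refine ⟨⋃ j, (K j).1, ⟨?_, ?_⟩, ⟨fun j => (K j).1, fun j => (K j).2, rfl⟩,
    subset_iUnion (fun j => (K j).1) 0⟩
  · refine isClosed_of_closure_subset fun y hy => ?_
    obtain ⟨i, hi⟩ := hv y
    obtain ⟨z, hzi, hz⟩ := mem_closure_iff.1 hy (v i) (hvo i) hi
    obtain ⟨j, hj⟩ := mem_iUnion.1 hz
    exact hK j i ⟨z, hzi, hj⟩ hi
  · refine isOpen_iff_mem_nhds.2 fun y hy => ?_
    obtain ⟨i, hi⟩ := hv y
    obtain ⟨j, hj⟩ := mem_iUnion.1 hy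
    exact mem_of_superset ((hvo i).mem_nhds hi) (hK j i ⟨y, hi, hj⟩)

namespace FullColombeau

/-! ### Smooth functions with compact sublevel sets -/

/-- A clopen `σ`-compact subset of a manifold carries a smooth exhaustion function, which extends
smoothly by zero. -/
theorem exists_contMDiffMap_isCompact_sublevel {m : ℕ} {Y : Type*} [TopologicalSpace Y]
    [T2Space Y] [ChartedSpace (EuclideanSpace ℝ (Fin m)) Y] [IsManifold (𝓡 m) ∞ Y]
    {S : Set Y} (hS : IsClopen S) (hσ : IsSigmaCompact S) :
    ∃ f : ContMDiffMap (𝓡 m) 𝓘(ℝ, ℝ) Y ℝ ∞, ∀ r : ℝ, ∃ L : Set Y, IsCompact L ∧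
      ∀ y ∈ S, f y ≤ r → y ∈ L := by
  let U : TopologicalSpace.Opens Y := ⟨S, hS.isOpen⟩
  have : LocallyCompactSpace Y := ChartedSpace.locallyCompactSpace (EuclideanSpace ℝ (Fin m)) Y
  have : LocallyCompactSpace U := hS.isOpen.locallyCompactSpace
  have : SigmaCompactSpace U := isSigmaCompact_iff_sigmaCompactSpace.1 hσ
  let E := CompactExhaustion.choice U
  obtain ⟨g, hg⟩ := exists_contMDiffMap_forall_mem_convex_of_local_const (𝓡 m) (n := ⊤)
    (t := fun y : U => Ici (E.find y : ℝ)) (fun _ => convex_Ici _) (fun y => by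
      obtain ⟨N, hN⟩ := E.exists_mem_nhds y
      refine ⟨N, mem_of_superset hN fun z hz => ?_⟩
      simpa using E.mem_iff_find_le.1 hz)
  classical
  let f : Y → ℝ := fun y => if h : y ∈ S then g ⟨y, h⟩ else 0
  have hf : ContMDiff (𝓡 m) 𝓘(ℝ, ℝ) ∞ f := by
    intro y
    by_cases hy : y ∈ S
    · have h : ContMDiffAt (𝓡 m) 𝓘(ℝ, ℝ) ∞ (fun z : U => f z) ⟨y, hy⟩ := by
        have : (fun z : U => f z) = g := by
          funext z
          exact dif_pos z.2
        rw [this]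
        exact g.contMDiff _
      exact contMDiffAt_subtype_iff.1 h
    · refine (contMDiffAt_const (c := (0 : ℝ))).congr_of_eventuallyEq ?_
      filter_upwards [hS.compl.isOpen.mem_nhds hy] with z hz
      exact dif_neg hz
  refine ⟨⟨f, hf⟩, fun r => ?_⟩
  obtain ⟨N, hN⟩ := exists_nat_ge r
  refine ⟨(↑) '' E N, (E.isCompact N).image continuous_subtype_val, fun y hy hyr => ?_⟩
  refine ⟨⟨y, hy⟩, E.mem_iff_find_le.2 ?_, rfl⟩
  have h1 : (E.find ⟨y, hy⟩ : ℝ) ≤ g ⟨y, hy⟩ := hg ⟨y, hy⟩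
  have h2 : g ⟨y, hy⟩ ≤ r := by
    have : f y = g ⟨y, hy⟩ := dif_pos hy
    exact this ▸ hyr
  exact_mod_cast h1.trans (h2.trans hN)

/-! ### Smooth curves in the space of forms of integral one -/

section Curves

variable {n : ℕ} {X : Type*} [TopologicalSpace X] [ChartedSpace (Model n) X]

theorem HasIntegral.add {A : OrientedAtlas n X} {ν μ : CompactForm n X} {a b : ℝ}
    (hν : HasIntegral A ν a) (hμ : HasIntegral A μ b) : HasIntegral A (ν + μ) (a + b) := by
  obtain ⟨N, e, η, h, rfl, rfl⟩ := hν
  obtain ⟨N', e', η', h', rfl, rfl⟩ := hμ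
  refine ⟨N + N', Fin.append e e', Fin.append η η', ?_, ?_, ?_⟩
  · refine Fin.addCases (fun i => ?_) (fun i => ?_)
    · simpa only [Fin.append_left] using h i
    · simpa only [Fin.append_right] using h' i
  · simp only [Fin.sum_univ_add, Fin.append_left, Fin.append_right]
  · simp only [Fin.sum_univ_add, Fin.append_left, Fin.append_right]

theorem HasIntegral.smul {A : OrientedAtlas n X} {ν : CompactForm n X} {a : ℝ}
    (hν : HasIntegral A ν a) (c : ℝ) : HasIntegral A (c • ν) (c * a) := by
  obtain ⟨N, e, η, h, rfl, rfl⟩ := hν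
  refine ⟨N, e, fun i => c • η i, fun i => ⟨(h i).1, ?_⟩, Finset.smul_sum, ?_⟩
  · exact (closure_mono (Function.support_const_smul_subset c (η i).toForm)).trans (h i).2
  · rw [Finset.mul_sum]
    refine Finset.sum_congr rfl fun i _ => ?_
    rw [← integral_const_mul]
    simp only [CompactForm.toForm_smul, pushForm_smul]
    rfl

/-- The line through two elements of the affine space `Û₀(X)`, at `ν` for `t = 0` and at `μ`
for `t = 1`. -/
def UHat.line {A : OrientedAtlas n X} (ν μ : UHat A) (t : ℝ) : UHat A :=
  ⟨(1 - t) • ν.form + t • μ.form, by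
    have h := (HasIntegral.smul ν.2 (1 - t)).add (HasIntegral.smul μ.2 t)
    rwa [mul_one, mul_one, sub_add_cancel] at h⟩

theorem UHat.line_zero {A : OrientedAtlas n X} (ν μ : UHat A) : UHat.line ν μ 0 = ν :=
  Subtype.ext (by simp [UHat.line, UHat.form])

theorem UHat.line_one {A : OrientedAtlas n X} (ν μ : UHat A) : UHat.line ν μ 1 = μ :=
  Subtype.ext (by simp [UHat.line, UHat.form])

theorem UHat.isSmoothUHatCurve_line {A : OrientedAtlas n X} (ν μ : UHat A) :
    IsSmoothUHatCurve (UHat.line ν μ) := by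
  refine ⟨fun k => match k with
    | 0 => fun t => (UHat.line ν μ t).form
    | 1 => fun _ => μ.form - ν.form
    | _ + 2 => fun _ => 0, rfl, fun k t s _ => ?_⟩
  refine tendsto_const_nhds.congr' ?_
  filter_upwards [self_mem_nhdsWithin] with h hh
  have hh : h ≠ 0 := hh
  match k with
  | 0 =>
    have : h⁻¹ • ((UHat.line ν μ (t + h)).form - (UHat.line ν μ t).form)
        - (μ.form - ν.form) = 0 := by
      have e : (UHat.line ν μ (t + h)).form - (UHat.line ν μ t).form
          = h • (μ.form - ν.form) := by
        simp only [UHat.line, UHat.form]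
        module
      rw [e, inv_smul_smul₀ hh, sub_self]
    simp only [this, map_zero]
  | 1 => simp
  | _ + 2 => simp

/-- Points close to `p` are joined to `p` by a smooth curve: a line segment in a chart, with
a reparametrization that makes it constant outside `[0, 1]`. -/
theorem eventually_exists_contMDiff_curve [IsManifold (𝓡 n) ∞ X] (p : X) :
    ∀ᶠ q in 𝓝 p, ∃ γ : ℝ → X, ContMDiff 𝓘(ℝ, ℝ) (𝓡 n) ∞ γ ∧ γ 0 = p ∧ γ 1 = q := by
  let e := chartAt (Model n) p
  have hp : p ∈ e.source := mem_chart_source _ p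
  obtain ⟨r, hr, hball⟩ := Metric.isOpen_iff.1 e.open_target (e p) (e.map_source hp)
  filter_upwards [e.open_source.mem_nhds hp,
    (e.continuousAt hp).preimage_mem_nhds (Metric.ball_mem_nhds _ hr)] with q hq hqr
  let c : ℝ → Model n := fun t => e p + Real.smoothTransition t • (e q - e p)
  have hc : ContDiff ℝ ∞ c :=
    contDiff_const.add (Real.smoothTransition.contDiff.smul contDiff_const)
  have hct : ∀ t, c t ∈ e.target := fun t => hball <|
    (convex_ball (e p) r).add_smul_sub_mem (Metric.mem_ball_self hr) hqr
      ⟨Real.smoothTransition.nonneg t, Real.smoothTransition.le_one t⟩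
  refine ⟨fun t => e.symm (c t), ?_, ?_, ?_⟩
  · exact (contMDiffOn_chart_symm (I := 𝓡 n) (n := ∞) (x := p)).comp_contMDiff hc.contMDiff hct
  · simp [c, e.left_inv hp]
  · simp [c, e.left_inv hq]

end Curves

/-! ### The range of an element of the basic space -/

section Range

variable {n : ℕ} {X : Type*} [TopologicalSpace X] [ChartedSpace (Model n) X]
  {F : Type*} [NormedAddCommGroup F] [NormedSpace ℝ F] {H : Type*} [TopologicalSpace H]
  {J : ModelWithCorners ℝ F H} {Y : Type*} [TopologicalSpace Y] [ChartedSpace H Y]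
  {A : OrientedAtlas n X}

theorem BasicSpace.mem_of_isClopen_of_curve (R : BasicSpace A J Y) {S : Set Y} (hS : IsClopen S)
    {c : ℝ → UHat A} {γ : ℝ → X} (hc : IsSmoothUHatCurve c)
    (hγ : ContMDiff 𝓘(ℝ, ℝ) (𝓡 n) ∞ γ) (h : R.toFun (c 0) (γ 0) ∈ S) :
    R.toFun (c 1) (γ 1) ∈ S := by
  have hpre := (hS.preimage (R.smooth c γ hc hγ).continuous).eq_univ ⟨0, h⟩
  exact (Set.eq_univ_iff_forall.1 hpre 1 :)

/-- `R(Û₀(X) × K)` meets only finitely many quasi-components of `Y` if `K` is compact. -/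
theorem BasicSpace.exists_finite_forall_isClopen_mem [IsManifold (𝓡 n) ∞ X]
    (R : BasicSpace A J Y) {K : Set X} (hK : IsCompact K) :
    ∃ s : Set Y, s.Finite ∧ ∀ S : Set Y, IsClopen S → s ⊆ S →
      ∀ ν : UHat A, ∀ p ∈ K, R.toFun ν p ∈ S := by
  rcases isEmpty_or_nonempty (UHat A) with h | ⟨⟨ν₀⟩⟩
  · exact ⟨∅, finite_empty, fun _ _ _ ν => h.elim ν⟩
  obtain ⟨P, -, hKP⟩ := hK.elim_nhds_subcover
    (fun p => {q | ∃ γ : ℝ → X, ContMDiff 𝓘(ℝ, ℝ) (𝓡 n) ∞ γ ∧ γ 0 = p ∧ γ 1 = q})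
    (fun p _ => eventually_exists_contMDiff_curve p)
  refine ⟨R.toFun ν₀ '' P, P.finite_toSet.image _, fun S hS hPS ν q hq => ?_⟩
  obtain ⟨p, hp, γ, hγ, rfl, rfl⟩ := mem_iUnion₂.1 (hKP hq)
  have h := R.mem_of_isClopen_of_curve hS (UHat.isSmoothUHatCurve_line ν₀ ν) hγ
    (by rw [UHat.line_zero]; exact hPS (mem_image_of_mem _ hp))
  rwa [UHat.line_one] at h

end Range

end FullColombeau

theorem proposition3p5 {n m : ℕ}
    {X : Type*} [TopologicalSpace X] [T2Space X] [ParacompactSpace X]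
    [ChartedSpace (EuclideanSpace ℝ (Fin n)) X] [IsManifold (𝓡 n) ∞ X]
    {Y : Type*} [TopologicalSpace Y] [T2Space Y] [ParacompactSpace Y]
    [ChartedSpace (EuclideanSpace ℝ (Fin m)) Y] [IsManifold (𝓡 m) ∞ Y]
    (𝕂 : Type*) [RCLike 𝕂]
    (A : FullColombeau.OrientedAtlas n X) (R : FullColombeau.BasicSpace A (𝓡 m) Y) :
    R.CBounded ↔
      ∀ f : ContMDiffMap (𝓡 m) 𝓘(ℝ, 𝕂) Y 𝕂 ∞, (R.postcomp f).CBounded := by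
  constructor
  · intro hR f K hK
    obtain ⟨L, hL, h⟩ := hR K hK
    refine ⟨f '' L, hL.image f.contMDiff.continuous, fun Φ => ?_⟩
    obtain ⟨ε₀, hε₀, h⟩ := h Φ
    exact ⟨ε₀, hε₀, fun ε hε p hp => mem_image_of_mem f (h ε hε p hp)⟩
  · intro hR K hK
    have : LocallyCompactSpace Y :=
      ChartedSpace.locallyCompactSpace (EuclideanSpace ℝ (Fin m)) Y
    obtain ⟨s, hs, hRs⟩ := R.exists_finite_forall_isClopen_mem hK
    obtain ⟨S, hS, hσ, hsS⟩ := hs.isCompact.exists_isClopen_isSigmaCompact_superset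
    obtain ⟨f, hf⟩ := FullColombeau.exists_contMDiffMap_isCompact_sublevel (m := m) hS hσ
    have hfK : ContMDiff (𝓡 m) 𝓘(ℝ, 𝕂) ∞ (fun y => (RCLike.ofRealCLM (f y) : 𝕂)) :=
      (RCLike.ofRealCLM (K := 𝕂)).contMDiff.comp f.contMDiff
    obtain ⟨L, hL, hRL⟩ := hR ⟨_, hfK⟩ K hK
    obtain ⟨r, hr⟩ := hL.isBounded.exists_norm_le
    obtain ⟨L', hL', hfL'⟩ := hf r
    refine ⟨L', hL', fun Φ => ?_⟩
    obtain ⟨ε₀, hε₀, h⟩ := hRL Φ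
    refine ⟨ε₀, hε₀, fun ε hε p hp => hfL' _ (hRs S hS hsS _ p hp) ?_⟩
    have hn : ‖(RCLike.ofRealCLM (f (R.toFun (Φ.toFun ε p) p)) : 𝕂)‖ ≤ r := hr _ (h ε hε p hp)
    rw [RCLike.ofRealCLM_apply, RCLike.norm_ofReal] at hn
    exact (le_abs_self _).trans hn
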